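/- Let $F\subseteq L$ be a field extension, let $X$ be an indeterminate, let $n\ge 1$ be an integer, and consider the subrings $$R=F+X^2L+X^4L+\cdots+X^{2n}L+X^{2n+2}L[X],\qquad S=F+X^3L+X^6L+\cdots+X^{3n}L+X^{3n+2}L[X]$$ of the polynomial ring $L[X]$. For a positive integer $m$, a proper ideal $I$ of a commutative ring $A$ is called $m$-absorbing if, whenever $x_1,\dots,x_{m+1}\in A$ and $x_1\cdots x_{m+1}\in I$, the product of some $m$ of the elements $x_1,\dots,x_{m+1}$ lies in $I$. The AF-dimension $\operatorname{AF-dim}(A)$ is the least positive integer $m$ such that every proper ideal of $A$ is a finite product of $m$-absorbing ideals, and $\infty$ if there is no such $m$; an FAF-domain is an integral domain of finite AF-dimension. A Mori domain is an integral domain $A$ satisfying the ascending chain condition on divisorial ideals, i.e. on the nonzero ideals $I$ of $A$ with $A:(A:I)=I$, where $A:J=\{x\in K\mid xJ\subseteq A\}$ and $K$ is the quotient field of $A$. Then: 1. $R$ and $S$ are Mori FAF-domains. 2. $\operatorname{AF-dim}(R)=2n+3$ and $\operatorname{AF-dim}(S)=2n+2$. Moreover, each of $R$ and $S$ is Noetherian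 if and only if $[L:F]<\infty$. -/

import Mathlib

open Polynomial

/-- A proper ideal `I` is `n`-absorbing if whenever a product of `n + 1` elements of the ring
lies in `I`, the product of some `n` of them lies in `I`. -/
def IsNAbsorbing {A : Type*} [CommRing A] (n : ℕ) (I : Ideal A) : Prop :=
  I ≠ ⊤ ∧ ∀ x : Fin (n + 1) → A, ∏ i, x i ∈ I → ∃ i, ∏ j ∈ Finset.univ.erase i, x j ∈ I

/-- Every proper ideal of `A` is a finite product of `n`-absorbing ideals. -/
def HasNAbsorbingFactorization (A : Type*) [CommRing A] (n : ℕ) : Prop :=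
  ∀ I : Ideal A, I ≠ ⊤ → ∃ s : Multiset (Ideal A), (∀ J ∈ s, IsNAbsorbing n J) ∧ s.prod = I

/-- The AF-dimension of `A`: the least positive integer `n` such that every proper ideal is a finite
product of `n`-absorbing ideals, and `⊤` if there is no such `n`. -/
noncomputable def AFdim (A : Type*) [CommRing A] : ℕ∞ :=
  ⨅ (n : ℕ) (_ : 1 ≤ n ∧ HasNAbsorbingFactorization A n), (n : ℕ∞)

/-- An FAF-domain is an integral domain of finite AF-dimension. -/
def IsFAFDomain (A : Type*) [CommRing A] : Prop :=
  IsDomain A ∧ AFdim A ≠ ⊤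

/-- An ideal `I` of a domain `A` with quotient field `K`, viewed as an `A`-submodule of `K`. -/
noncomputable def idealInFractionRing {A : Type*} [CommRing A] (I : Ideal A) :
    Submodule A (FractionRing A) :=
  Submodule.map (Algebra.linearMap A (FractionRing A)) I

/-- A nonzero ideal `I` of a domain `A` is divisorial if `A : (A : I) = I`. Here
`1 : Submodule A K` is `A` itself, and the quotient of submodules `P / Q` of `K` is
`{x ∈ K | x Q ⊆ P}`. -/
def IsDivisorialIdeal {A : Type*} [CommRing A] (I : Ideal A) : Prop :=
  I ≠ ⊥ ∧ 1 / (1 / idealInFractionRing I) = idealInFractionRing I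

/-- A Mori domain is an integral domain with the ascending chain condition on divisorial ideals. -/
def IsMoriDomain (A : Type*) [CommRing A] : Prop :=
  IsDomain A ∧ ∀ I : ℕ → Ideal A, (∀ k, IsDivisorialIdeal (I k)) → Monotone I →
    ∃ m, ∀ k, m ≤ k → I k = I m

/-- The polynomials over `L` with constant coefficient in `F` in which no power `X ^ i` with
`i < e` and `i` not divisible by `d` occurs. -/
def gapSubalgebra (F L : Type*) [Field F] [Field L] [Algebra F L] (d e : ℕ) :
    Subalgebra F L[X] where
  carrier := {p | p.coeff 0 ∈ (algebraMap F L).range ∧ ∀ i < e, ¬ d ∣ i → p.coeff i = 0}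
  mul_mem' := by
    rintro p q ⟨hp, hp'⟩ ⟨hq, hq'⟩
    refine ⟨by rw [mul_coeff_zero]; exact mul_mem hp hq, fun i hi hd => ?_⟩
    rw [coeff_mul]
    refine Finset.sum_eq_zero fun x hx => ?_
    have hx' := Finset.HasAntidiagonal.mem_antidiagonal.1 hx
    by_cases h1 : d ∣ x.1
    · have h2 : ¬ d ∣ x.2 := fun h2 => hd (hx' ▸ dvd_add h1 h2)
      rw [hq' _ (by omega) h2, mul_zero]
    · rw [hp' _ (by omega) h1, zero_mul]
  add_mem' := by
    rintro p q ⟨hp, hp'⟩ ⟨hq, hq'⟩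
    refine ⟨by rw [coeff_add]; exact add_mem hp hq, fun i hi hd => ?_⟩
    rw [coeff_add, hp' i hi hd, hq' i hi hd, add_zero]
  algebraMap_mem' := by
    intro a
    refine ⟨⟨a, by simp [Polynomial.algebraMap_apply]⟩, fun i _ hd => ?_⟩
    rw [Polynomial.algebraMap_apply, coeff_C, if_neg]
    rintro rfl
    exact hd (dvd_zero d)

theorem exists_sum_iff_mem_gapSubalgebra (F L : Type*) [Field F] [Field L] [Algebra F L]
    (d n : ℕ) (hd : 2 ≤ d) (p : L[X]) :
    (∃ (a : F) (c : ℕ → L) (q : L[X]), p = C (algebraMap F L a)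
        + ∑ i ∈ Finset.Icc 1 n, X ^ (d * i) * C (c i) + X ^ (d * n + 2) * q) ↔
      p ∈ gapSubalgebra F L d (d * n + 2) := by
  constructor
  · rintro ⟨a, c, q, rfl⟩
    refine add_mem (add_mem ((gapSubalgebra F L d (d * n + 2)).algebraMap_mem a)
      (sum_mem fun i hi => ?_)) ?_
    · have h1 := (Finset.mem_Icc.1 hi).1
      have h2 : d * i ≠ 0 := by positivity
      refine ⟨⟨0, ?_⟩, fun j _ hj => ?_⟩
      · rw [coeff_mul_C, coeff_X_pow, if_neg h2.symm, zero_mul, map_zero]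
      · rw [coeff_mul_C, coeff_X_pow, if_neg, zero_mul]
        rintro rfl
        exact hj (dvd_mul_right d i)
    · refine ⟨⟨0, ?_⟩, fun j hj _ => ?_⟩
      · rw [coeff_X_pow_mul', if_neg (by omega), map_zero]
      · rw [coeff_X_pow_mul', if_neg (by omega)]
  · rintro ⟨⟨a, ha⟩, h⟩
    have hdvd : X ^ (d * n + 2) ∣ p - (C (algebraMap F L a)
        + ∑ i ∈ Finset.Icc 1 n, X ^ (d * i) * C (p.coeff (d * i))) := by
      rw [X_pow_dvd_iff]
      intro j hj
      simp only [coeff_sub, coeff_add, finsetSum_coeff, coeff_mul_C, coeff_X_pow]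
      by_cases hdj : d ∣ j
      · obtain ⟨k, rfl⟩ := hdj
        have hinj : ∀ i, (d * k = d * i) ↔ k = i := fun i =>
          Nat.mul_right_inj (by omega)
        simp only [hinj, ite_mul, one_mul, zero_mul, Finset.sum_ite_eq]
        rcases Nat.eq_zero_or_pos k with rfl | hk
        · simp [ha]
        · have hkn : k ≤ n := by
            by_contra hlt
            have : d * (n + 1) ≤ d * k := Nat.mul_le_mul_left d (by omega)
            rw [mul_add] at this
            omega
          rw [coeff_C, if_neg (by positivity), if_pos (Finset.mem_Icc.2 ⟨hk, hkn⟩)]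
          ring
      · rw [h j hj hdj, coeff_C, if_neg, Finset.sum_eq_zero]
        · ring
        · intro i _
          rw [if_neg, zero_mul]
          rintro rfl
          exact hdj (dvd_mul_right d i)
        · rintro rfl
          exact hdj (dvd_zero d)
    obtain ⟨q, hq⟩ := hdvd
    exact ⟨a, fun i => p.coeff (d * i), q, by rw [← hq]; ring⟩

/-- The ring `F + X²L + X⁴L + ⋯ + X²ⁿL + X²ⁿ⁺²L[X]`. -/
noncomputable def evenGapRing (F L : Type*) [Field F] [Field L] [Algebra F L] (n : ℕ) : Subalgebra F L[X] :=
  (gapSubalgebra F L 2 (2 * n + 2)).copy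
    {p | ∃ (a : F) (c : ℕ → L) (q : L[X]), p = C (algebraMap F L a)
        + ∑ i ∈ Finset.Icc 1 n, X ^ (2 * i) * C (c i) + X ^ (2 * n + 2) * q}
    (Set.ext fun p => exists_sum_iff_mem_gapSubalgebra F L 2 n (by norm_num) p)

/-- The ring `F + X³L + X⁶L + ⋯ + X³ⁿL + X³ⁿ⁺²L[X]`. -/
noncomputable def tripleGapRing (F L : Type*) [Field F] [Field L] [Algebra F L] (n : ℕ) : Subalgebra F L[X] :=
  (gapSubalgebra F L 3 (3 * n + 2)).copy
    {p | ∃ (a : F) (c : ℕ → L) (q : L[X]), p = C (algebraMap F L a)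
        + ∑ i ∈ Finset.Icc 1 n, X ^ (3 * i) * C (c i) + X ^ (3 * n + 2) * q}
    (Set.ext fun p => exists_sum_iff_mem_gapSubalgebra F L 3 n (by norm_num) p)

/-! ### Ideals of the gap ring -/

section GapSubalgebra

variable {F L : Type*} [Field F] [Field L] [Algebra F L] {d e : ℕ}

/-! Both rings are gap rings `A`, with `(d, e) = (2, 2n+2)` and `(3, 3n+2)`. Two facts drive
everything: `X^e L[X]` lies in `A`, and the elements of `A` without constant term form a maximal
ideal `M` contained in `X^d L[X]`. The AF-dimension is the least `m₀` with `2e + d - 1 ≤ d m₀`.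

Upper bound: if a nonzero ideal `I` generates `g L[X]`, then `g X^e L[X] ⊆ I ⊆ g L[X]`. Primes
coprime to `X` and copies of `(X^d)` split off until `g` is a power of `X` below `X^(e+d)`; the
remaining factor is `A` or an ideal containing `X^(2e+d-1) L[X]`, hence `m₀`-absorbing
(`exists_isNAbsorbing_factorization`).

Lower bound: `(X^(e+d-1))` is not contained in `M^2`, so it has no proper factorization and must
itself be absorbing; powers of `X^d` show that this needs `m₀` factors.

Noetherianity is Artin–Tate in one direction and a count of coefficients at `X^e` in the other. The
Mori property comes from the Noetherian gap ring with constants in `L`, of which `M` is also an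
ideal. -/

theorem mem_gapSubalgebra_of_X_pow_dvd (he : 0 < e) {p : L[X]} (h : X ^ e ∣ p) :
    p ∈ gapSubalgebra F L d e := by
  rw [X_pow_dvd_iff] at h
  exact ⟨⟨0, by rw [h 0 he, map_zero]⟩, fun i hi _ => h i hi⟩

theorem X_pow_mul_mem_gapSubalgebra (hd : 0 < d) (j : ℕ) :
    (X ^ (d * j) : L[X]) ∈ gapSubalgebra F L d e := by
  rw [pow_mul]
  refine pow_mem (show (X ^ d : L[X]) ∈ gapSubalgebra F L d e from ⟨⟨0, ?_⟩, fun i _ hi => ?_⟩) j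
  · rw [coeff_X_pow, if_neg hd.ne, map_zero]
  · rw [coeff_X_pow, if_neg]
    rintro rfl
    exact hi dvd_rfl

variable (F L d e) in
/-- The ideal of all elements of the gap ring that are multiples of `g` in `L[X]`. -/
noncomputable def gapMultiples (g : L[X]) : Ideal (gapSubalgebra F L d e) :=
  Ideal.comap (algebraMap (gapSubalgebra F L d e) L[X]) (Ideal.span {g})

theorem mem_gapMultiples {g : L[X]} {f : gapSubalgebra F L d e} :
    f ∈ gapMultiples F L d e g ↔ g ∣ (f : L[X]) :=
  Ideal.mem_span_singleton

theorem gapMultiples_X_ne_top : gapMultiples F L d e X ≠ ⊤ := by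
  rw [Ideal.ne_top_iff_one, mem_gapMultiples, X_dvd_iff]
  simp

theorem X_pow_dvd_of_mem_gapMultiples_X (hde : d ≤ e) {f : gapSubalgebra F L d e}
    (hf : f ∈ gapMultiples F L d e X) : X ^ d ∣ (f : L[X]) := by
  rw [mem_gapMultiples, X_dvd_iff] at hf
  rw [X_pow_dvd_iff]
  intro i hi
  rcases Nat.eq_zero_or_pos i with rfl | h0
  · exact hf
  · exact f.2.2 i (by omega) (Nat.not_dvd_of_pos_of_lt h0 hi)

/-- An ideal containing all multiples of a power of `X` and an element with nonzero constant term
is the whole ring. -/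
theorem eq_top_of_gapMultiples_X_pow_le {N : ℕ} {J : Ideal (gapSubalgebra F L d e)}
    (hJ : gapMultiples F L d e (X ^ N) ≤ J) (h : ¬ J ≤ gapMultiples F L d e X) : J = ⊤ := by
  obtain ⟨x, hx, hxM⟩ := SetLike.not_le_iff_exists.1 h
  rw [mem_gapMultiples, X_dvd_iff] at hxM
  obtain ⟨a, ha⟩ := x.2.1
  have ha0 : a ≠ 0 := by
    rintro rfl
    exact hxM (by rw [← ha, map_zero])
  -- Modulo `J`, `y` is `1`, yet `y ^ N` is a multiple of `X ^ N` and so lies in `J`.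
  set y : gapSubalgebra F L d e := 1 - a⁻¹ • x with hy
  have hyX : X ∣ (y : L[X]) := by
    rw [X_dvd_iff]
    have : (y : L[X]) = 1 - a⁻¹ • (x : L[X]) := rfl
    rw [this, coeff_sub, coeff_smul, ← ha, coeff_one_zero, Algebra.smul_def, ← map_mul,
      inv_mul_cancel₀ ha0, map_one, sub_self]
  have hyN : y ^ N ∈ J := hJ (mem_gapMultiples.2 (pow_dvd_pow_of_dvd hyX N))
  have h1 : 1 - y ^ N ∈ J := by
    have h2 : 1 - y ∣ 1 - y ^ N := by simpa using sub_dvd_pow_sub_pow 1 y N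
    refine J.mem_of_dvd h2 ?_
    rw [hy, sub_sub_cancel]
    exact J.smul_of_tower_mem _ hx
  rw [Ideal.eq_top_iff_one]
  simpa using add_mem h1 hyN

theorem isMaximal_gapMultiples_X : (gapMultiples F L d e X).IsMaximal := by
  refine Ideal.isMaximal_def.2 ⟨gapMultiples_X_ne_top, fun J hJ => ?_⟩
  exact eq_top_of_gapMultiples_X_pow_le (N := 1) (by simpa using hJ.le) hJ.not_ge

theorem isPrime_isNAbsorbing {A : Type*} [CommRing A] {m : ℕ} (hm : 1 ≤ m) {P : Ideal A}
    (hP : P.IsPrime) : IsNAbsorbing m P := by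
  refine ⟨hP.ne_top, fun x hx => ?_⟩
  obtain ⟨i, -, hi⟩ := (hP.prod_mem_iff).1 hx
  have : Nontrivial (Fin (m + 1)) := Fin.nontrivial_iff_two_le.2 (by omega)
  obtain ⟨j, hj⟩ := exists_ne i
  exact ⟨j, P.mem_of_dvd (Finset.dvd_prod_of_mem x (Finset.mem_erase.2 ⟨hj.symm, Finset.mem_univ i⟩))
    hi⟩

/-- If all factors lie in `M`, each is a multiple of `X^d`, so any `m` of them multiply to a
multiple of `X^(dm)`. Otherwise some factor is a unit modulo `I` and can be cancelled. -/
theorem isNAbsorbing_of_gapMultiples_X_pow_le (hde : d ≤ e) {m N : ℕ} (hN : N ≤ d * m)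
    {I : Ideal (gapSubalgebra F L d e)} (hI : gapMultiples F L d e (X ^ N) ≤ I) (hI1 : I ≠ ⊤) :
    IsNAbsorbing m I := by
  refine ⟨hI1, fun x hx => ?_⟩
  by_cases h : ∀ i, x i ∈ gapMultiples F L d e X
  · refine ⟨0, hI (mem_gapMultiples.2 ((pow_dvd_pow X hN).trans ?_))⟩
    have h1 := Finset.prod_dvd_prod_of_dvd (s := Finset.univ.erase (0 : Fin (m + 1)))
      (fun _ => (X ^ d : L[X])) (fun i => (x i : L[X]))
      fun i _ => X_pow_dvd_of_mem_gapMultiples_X hde (h i)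
    rw [Finset.prod_const, Finset.card_erase_of_mem (Finset.mem_univ _), Finset.card_univ,
      Fintype.card_fin, Nat.add_sub_cancel, ← pow_mul] at h1
    simpa using h1
  · push Not at h
    obtain ⟨i, hi⟩ := h
    refine ⟨i, ?_⟩
    have htop : I ⊔ Ideal.span {x i} = ⊤ :=
      eq_top_of_gapMultiples_X_pow_le (hI.trans le_sup_left) fun hle =>
        hi (hle (Ideal.mem_sup_right (Ideal.mem_span_singleton_self _)))
    obtain ⟨z, hz, w, hw, hzw⟩ := Submodule.mem_sup.1 ((Ideal.eq_top_iff_one _).1 htop)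
    obtain ⟨y, rfl⟩ := Ideal.mem_span_singleton'.1 hw
    have h2 : ∏ j ∈ Finset.univ.erase i, x j
        = z * ∏ j ∈ Finset.univ.erase i, x j + y * ∏ j, x j := by
      rw [← Finset.mul_prod_erase Finset.univ x (Finset.mem_univ i)]
      linear_combination (-∏ j ∈ Finset.univ.erase i, x j) * hzw
    rw [h2]
    exact add_mem (I.mul_mem_right _ hz) (I.mul_mem_left _ hx)

/-- Splitting off a prime factor coprime to `X`. -/
theorem eq_gapMultiples_mul_sup (he : 0 < e) {p g : L[X]} (hp : IsCoprime p (X ^ e))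
    {I : Ideal (gapSubalgebra F L d e)} (h1 : I ≤ gapMultiples F L d e (p * g))
    (h2 : gapMultiples F L d e (p * g * X ^ e) ≤ I) :
    gapMultiples F L d e p * (I ⊔ gapMultiples F L d e (g * X ^ e)) = I := by
  refine le_antisymm (Ideal.mul_le.2 fun r hr s hs => ?_) fun x hx => ?_
  · obtain ⟨a, ha, b, hb, rfl⟩ := Submodule.mem_sup.1 hs
    rw [mul_add]
    refine add_mem (I.mul_mem_left _ ha) (h2 (mem_gapMultiples.2 ?_))
    rw [mul_assoc]
    exact mul_dvd_mul (mem_gapMultiples.1 hr) (mem_gapMultiples.1 hb)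
  -- From `s p + w X^e = 1`, both `s p` and `w X^e` lie in the ring. Expanding `x` along this
  -- relation, and its `w X^e` part once more, gives `x = p₁ x + p₁ y + a b`.
  · obtain ⟨s, w, hsw⟩ := hp
    obtain ⟨u, hu⟩ := mem_gapMultiples.1 (h1 hx)
    have hps : s * p ∈ gapSubalgebra F L d e := by
      rw [eq_sub_of_add_eq hsw]
      exact sub_mem (one_mem _) (mem_gapSubalgebra_of_X_pow_dvd he (dvd_mul_left _ _))
    let p₁ : gapSubalgebra F L d e := ⟨s * p, hps⟩
    let y : gapSubalgebra F L d e :=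
      ⟨(x : L[X]) * (w * X ^ e), mem_gapSubalgebra_of_X_pow_dvd he ⟨(x : L[X]) * w, by ring⟩⟩
    let a : gapSubalgebra F L d e :=
      ⟨p * (w * X ^ e), mem_gapSubalgebra_of_X_pow_dvd he ⟨p * w, by ring⟩⟩
    let b : gapSubalgebra F L d e :=
      ⟨g * u * (w * X ^ e), mem_gapSubalgebra_of_X_pow_dvd he ⟨g * u * w, by ring⟩⟩
    have hy : y ∈ I := h2 (mem_gapMultiples.2 ⟨u * w, by
      change (x : L[X]) * (w * X ^ e) = _
      rw [hu]
      ring⟩)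
    have hx' : x = p₁ * x + p₁ * y + a * b := by
      refine Subtype.ext ?_
      change (x : L[X]) = s * p * (x : L[X]) + s * p * ((x : L[X]) * (w * X ^ e))
        + p * (w * X ^ e) * (g * u * (w * X ^ e))
      linear_combination (-(x : L[X]) * (1 + w * X ^ e)) * hsw + (w * X ^ e) ^ 2 * hu
    rw [hx']
    have hp₁ : p₁ ∈ gapMultiples F L d e p := mem_gapMultiples.2 (dvd_mul_left _ _)
    exact add_mem (add_mem (Ideal.mul_mem_mul hp₁ (Ideal.mem_sup_left hx))
      (Ideal.mul_mem_mul hp₁ (Ideal.mem_sup_left hy)))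
      (Ideal.mul_mem_mul (mem_gapMultiples.2 (dvd_mul_right _ _))
        (Ideal.mem_sup_right (mem_gapMultiples.2 ⟨u * w, by
          change g * u * (w * X ^ e) = _
          ring⟩)))

/-! ### Upper bound: factorizations into absorbing ideals -/

/-- Strong induction on the degree of `g`. The sandwich `g X^e L[X] ⊆ I ⊆ g L[X]` survives each
splitting, with `g` replaced by a proper divisor. -/
theorem exists_isNAbsorbing_factorization (hd : 0 < d) (hde : d ≤ e) {m : ℕ}
    (hm : 2 * e + d - 1 ≤ d * m) (N : ℕ) : ∀ g : L[X], g ≠ 0 → g.natDegree ≤ N →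
      ∀ I : Ideal (gapSubalgebra F L d e), I ≤ gapMultiples F L d e g →
      gapMultiples F L d e (g * X ^ e) ≤ I →
      ∃ s : Multiset (Ideal (gapSubalgebra F L d e)), (∀ J ∈ s, IsNAbsorbing m J) ∧ s.prod = I := by
  have hm1 : 1 ≤ m := by
    rcases Nat.eq_zero_or_pos m with rfl | h
    · omega
    · exact h
  have he : 0 < e := hd.trans_le hde
  induction N using Nat.strong_induction_on with
  | _ N ih =>
  intro g hg0 hgN I h1 h2
  by_cases htop : I = ⊤
  · exact ⟨0, by simp, by rw [Multiset.prod_zero, htop, Ideal.one_eq_top]⟩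
  obtain ⟨h, hgh, hXh⟩ := exists_eq_pow_rootMultiplicity_mul_and_not_dvd g hg0 0
  rw [C_0, sub_zero] at hgh hXh
  set k := rootMultiplicity 0 g
  by_cases hu : IsUnit h
  · have hk : ∀ f : L[X], g ∣ f ↔ X ^ k ∣ f := fun f => by rw [hgh, hu.mul_right_dvd]
    have hk' : ∀ f : L[X], g * X ^ e ∣ f ↔ X ^ (k + e) ∣ f := fun f => by
      rw [hgh, mul_right_comm, hu.mul_right_dvd, pow_add]
    -- Below this threshold `k + e ≤ 2e + d - 1 ≤ d m`, so `I` itself is absorbing. From it on,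
    -- elements of `I` divided by `X^d` remain in `X^e L[X]`, hence in the ring, and `(X^d)` splits
    -- off.
    by_cases hke : k < e + d
    · refine ⟨{I}, fun J hJ => ?_, Multiset.prod_singleton I⟩
      rw [Multiset.mem_singleton.1 hJ]
      refine isNAbsorbing_of_gapMultiples_X_pow_le hde (N := k + e) (by omega) (fun f hf => ?_) htop
      exact h2 (mem_gapMultiples.2 ((hk' _).2 (mem_gapMultiples.1 hf)))
    · push Not at hke
      let x : gapSubalgebra F L d e := ⟨X ^ d, by
        simpa using X_pow_mul_mem_gapSubalgebra (F := F) (L := L) (e := e) hd 1⟩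
      have hx : IsNAbsorbing m (Ideal.span {x}) := by
        refine isNAbsorbing_of_gapMultiples_X_pow_le hde (N := d + e) (by omega) (fun f hf => ?_) ?_
        · obtain ⟨q, hq⟩ := mem_gapMultiples.1 hf
          refine Ideal.mem_span_singleton.2
            ⟨⟨X ^ e * q, mem_gapSubalgebra_of_X_pow_dvd he (dvd_mul_right _ _)⟩, Subtype.ext ?_⟩
          change (f : L[X]) = X ^ d * (X ^ e * q)
          rw [hq]
          ring
        · intro h
          refine gapMultiples_X_ne_top (F := F) (L := L) (d := d) (e := e) (top_unique ?_)
          rw [← h, Ideal.span_singleton_le_iff_mem, mem_gapMultiples]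
          exact dvd_pow_self X hd.ne'
      -- The colon ideal `I : X^d`, sandwiched with `X^(k-d)` in place of `X^k`.
      let I' : Ideal (gapSubalgebra F L d e) :=
        Submodule.comap (LinearMap.mulLeft (gapSubalgebra F L d e) x) I
      have hI' : Ideal.span {x} * I' = I := by
        refine le_antisymm (Ideal.mul_le.2 fun r hr s hs => ?_) fun f hf => ?_
        · obtain ⟨c, rfl⟩ := Ideal.mem_span_singleton'.1 hr
          rw [mul_assoc]
          exact I.mul_mem_left _ hs
        · obtain ⟨q, hq⟩ := (pow_dvd_pow X hke).trans ((hk _).1 (mem_gapMultiples.1 (h1 hf)))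
          let f' : gapSubalgebra F L d e :=
            ⟨X ^ e * q, mem_gapSubalgebra_of_X_pow_dvd he (dvd_mul_right _ _)⟩
          have hf' : f = x * f' := Subtype.ext (by
            change (f : L[X]) = X ^ d * (X ^ e * q)
            rw [hq]
            ring)
          rw [hf']
          refine Ideal.mul_mem_mul (Ideal.mem_span_singleton_self x) ?_
          change x * f' ∈ I
          rwa [← hf']
      have hkN : k ≤ N := by
        refine le_trans ?_ hgN
        rw [hgh, natDegree_mul (pow_ne_zero _ X_ne_zero) hu.ne_zero, natDegree_X_pow]
        exact Nat.le_add_right _ _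
      have h1' : I' ≤ gapMultiples F L d e (X ^ (k - d)) := fun f hf => by
        have h3 : X ^ k ∣ X ^ d * (f : L[X]) := (hk _).1 (mem_gapMultiples.1 (h1 hf))
        rw [mem_gapMultiples]
        rw [← Nat.add_sub_cancel' (show d ≤ k by omega), pow_add] at h3
        exact (mul_dvd_mul_iff_left (pow_ne_zero _ X_ne_zero)).1 h3
      have h2' : gapMultiples F L d e (X ^ (k - d) * X ^ e) ≤ I' := fun f hf => by
        refine h2 (mem_gapMultiples.2 ((hk' _).2 ?_))
        change X ^ (k + e) ∣ X ^ d * (f : L[X])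
        rw [show k + e = d + (k - d + e) by omega, pow_add, pow_add]
        exact mul_dvd_mul_left _ (mem_gapMultiples.1 hf)
      obtain ⟨s, hs, hsI⟩ := ih (k - d) (by omega) (X ^ (k - d)) (pow_ne_zero _ X_ne_zero)
        (by rw [natDegree_X_pow]) I' h1' h2'
      refine ⟨Ideal.span {x} ::ₘ s, fun J hJ => ?_, by rw [Multiset.prod_cons, hsI, hI']⟩
      rcases Multiset.mem_cons.1 hJ with rfl | hJ
      · exact hx
      · exact hs J hJ
  · have hh0 : h ≠ 0 := by
      rintro rfl
      exact hXh (dvd_zero _)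
    obtain ⟨p, hp, q, hq⟩ := WfDvdMonoid.exists_irreducible_factor hu hh0
    have hpX : IsCoprime p (X ^ e) := by
      refine hp.coprime_iff_not_dvd.2 fun hdvd => hXh ?_
      have h3 : p ∣ X := hp.prime.dvd_of_dvd_pow hdvd
      exact ((hp.dvd_symm irreducible_X) h3).trans ⟨q, hq⟩
    have hg' : g = p * (X ^ k * q) := by rw [hgh, hq]; ring
    have hq0 : X ^ k * q ≠ 0 := by
      intro h0
      rw [h0, mul_zero] at hg'
      exact hg0 hg'
    have hdeg : (X ^ k * q).natDegree < g.natDegree := by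
      rw [hg', natDegree_mul hp.ne_zero hq0]
      have := hp.natDegree_pos
      omega
    rw [hg'] at h1 h2
    obtain ⟨s, hs, hsI⟩ := ih _ (hdeg.trans_le hgN) (X ^ k * q) hq0 le_rfl
      (I ⊔ gapMultiples F L d e (X ^ k * q * X ^ e))
      (sup_le (fun f hf => mem_gapMultiples.2
          ((dvd_mul_left _ _).trans (mem_gapMultiples.1 (h1 hf))))
        fun f hf => mem_gapMultiples.2 ((dvd_mul_right _ _).trans (mem_gapMultiples.1 hf)))
      le_sup_right
    refine ⟨gapMultiples F L d e p ::ₘ s, fun J hJ => ?_, ?_⟩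
    · rcases Multiset.mem_cons.1 hJ with rfl | hJ
      · have : (Ideal.span {p}).IsPrime := (Ideal.span_singleton_prime hp.ne_zero).2 hp.prime
        exact isPrime_isNAbsorbing hm1 (Ideal.comap_isPrime _ _)
      · exact hs J hJ
    · rw [Multiset.prod_cons, hsI, eq_gapMultiples_mul_sup he hpX h1 h2]

theorem hasNAbsorbingFactorization_gapSubalgebra (hd : 0 < d) (hde : d ≤ e) {m : ℕ}
    (hm : 2 * e + d - 1 ≤ d * m) : HasNAbsorbingFactorization (gapSubalgebra F L d e) m := by
  intro I hI
  have hm1 : 1 ≤ m := by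
    rcases Nat.eq_zero_or_pos m with rfl | h
    · omega
    · exact h
  by_cases hbot : I = ⊥
  · refine ⟨{I}, fun J hJ => ?_, Multiset.prod_singleton I⟩
    rw [Multiset.mem_singleton.1 hJ, hbot]
    exact isPrime_isNAbsorbing hm1 Ideal.isPrime_bot
  let φ := algebraMap (gapSubalgebra F L d e) L[X]
  obtain ⟨g, hg⟩ := (IsPrincipalIdealRing.principal (I.map φ)).principal
  have h1 : I ≤ gapMultiples F L d e g := fun f hf => by
    have : φ f ∈ I.map φ := Ideal.mem_map_of_mem φ hf
    rw [hg] at this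
    exact mem_gapMultiples.2 (Ideal.mem_span_singleton.1 this)
  have he : 0 < e := hd.trans_le hde
  -- `X^e L[X]` is an ideal of `L[X]` inside the ring, so it absorbs the `L[X]`-coefficients and
  -- multiplies `I L[X]` back into `I`.
  have key : ∀ t ∈ I.map φ, ∀ c : L[X], X ^ e ∣ c → ∀ f : gapSubalgebra F L d e,
      (f : L[X]) = t * c → f ∈ I := by
    intro t ht
    refine Submodule.span_induction ?_ ?_ ?_ ?_ ht
    · rintro _ ⟨x, hx, rfl⟩ c hc f hf
      have : f = x * ⟨c, mem_gapSubalgebra_of_X_pow_dvd he hc⟩ := Subtype.ext hf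
      rw [this]
      exact I.mul_mem_right _ hx
    · intro c _ f hf
      rw [zero_mul] at hf
      rw [show f = 0 from Subtype.ext hf]
      exact I.zero_mem
    · intro t₁ t₂ _ _ h₁ h₂ c hc f hf
      rw [add_mul] at hf
      let f₁ : gapSubalgebra F L d e :=
        ⟨t₁ * c, mem_gapSubalgebra_of_X_pow_dvd he (hc.mul_left _)⟩
      let f₂ : gapSubalgebra F L d e :=
        ⟨t₂ * c, mem_gapSubalgebra_of_X_pow_dvd he (hc.mul_left _)⟩
      rw [show f = f₁ + f₂ from Subtype.ext hf]
      exact add_mem (h₁ c hc f₁ rfl) (h₂ c hc f₂ rfl)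
    · intro a t _ h c hc f hf
      refine h (a * c) (hc.mul_left _) f ?_
      rw [hf, smul_eq_mul]
      ring
  have hg0 : g ≠ 0 := by
    rintro rfl
    refine hbot (le_bot_iff.1 fun f hf => ?_)
    exact Subtype.ext (zero_dvd_iff.1 (mem_gapMultiples.1 (h1 hf)))
  refine exists_isNAbsorbing_factorization hd hde hm _ g hg0 le_rfl I h1 fun f hf => ?_
  obtain ⟨u, hu⟩ := mem_gapMultiples.1 hf
  refine key (g * u) ?_ (X ^ e) dvd_rfl f (by rw [hu]; ring)
  rw [hg]
  exact Ideal.mem_span_singleton.2 (dvd_mul_right _ _)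

end GapSubalgebra

/-! ### Lower bound and the value of the AF-dimension -/

section AFdim

variable {F L : Type*} [Field F] [Field L] [Algebra F L] {d e : ℕ}

/-- Elements of `M` start in degree `d`, so a contribution to degree `e + d - 1` uses two degrees
below `e`. One of them is not divisible by `d`, and its coefficient vanishes. -/
theorem coeff_eq_zero_of_mem_mul (hd : 0 < d) (hde : d ≤ e) (hdk : ¬ d ∣ e + d - 1)
    {f : gapSubalgebra F L d e} (hf : f ∈ gapMultiples F L d e X * gapMultiples F L d e X) :
    (f : L[X]).coeff (e + d - 1) = 0 := by
  refine Submodule.mul_induction_on hf (fun a ha b hb => ?_) fun a b ha hb => ?_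
  · change ((a : L[X]) * (b : L[X])).coeff (e + d - 1) = 0
    rw [coeff_mul]
    refine Finset.sum_eq_zero fun x hx => ?_
    have hx' := Finset.HasAntidiagonal.mem_antidiagonal.1 hx
    have ha' := X_pow_dvd_iff.1 (X_pow_dvd_of_mem_gapMultiples_X hde ha)
    have hb' := X_pow_dvd_iff.1 (X_pow_dvd_of_mem_gapMultiples_X hde hb)
    by_cases h1 : x.1 < d
    · rw [ha' _ h1, zero_mul]
    by_cases h2 : x.2 < d
    · rw [hb' _ h2, mul_zero]
    by_cases h3 : d ∣ x.1
    · have h4 : ¬ d ∣ x.2 := fun h4 => hdk (hx' ▸ dvd_add h3 h4)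
      rw [b.2.2 _ (by omega) h4, mul_zero]
    · rw [a.2.2 _ (by omega) h3, zero_mul]
  · change ((a : L[X]) + (b : L[X])).coeff (e + d - 1) = 0
    rw [coeff_add, ha, hb, add_zero]

/-- A quotient would be a power of `X` with exponent below `e` and not divisible by `d`, which is
not in the ring. -/
theorem X_pow_mul_notMem_span (hdk : ¬ d ∣ e + d - 1) {x y : gapSubalgebra F L d e}
    (hx : (x : L[X]) = X ^ (e + d - 1)) {j : ℕ} (hj : d * j < 2 * e + d - 1)
    (hy : (y : L[X]) = X ^ (d * j)) : y ∉ Ideal.span {x} := by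
  rintro hmem
  obtain ⟨a, ha⟩ := Ideal.mem_span_singleton.1 hmem
  have h1 : (X ^ (d * j) : L[X]) = X ^ (e + d - 1) * (a : L[X]) := by
    rw [← hy, ← hx, ha]
    rfl
  have h2 := congrArg (fun p => coeff p (d * j)) h1
  simp only [coeff_X_pow_self, coeff_X_pow_mul'] at h2
  split_ifs at h2 with h3
  · refine one_ne_zero (h2.trans (a.2.2 _ (by omega) fun h4 => hdk ?_))
    have h5 := (Nat.dvd_sub_iff_right h3 (dvd_mul_right d j)).1 h4
    exact h5
  · exact one_ne_zero h2

theorem not_hasNAbsorbingFactorization_gapSubalgebra (hd : 0 < d) (hde : d ≤ e)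
    (hdk : ¬ d ∣ e + d - 1) {m m₀ : ℕ} (hm₀ : 2 * e + d - 1 ≤ d * m₀)
    (hm₀' : d * (m₀ - 1) < 2 * e + d - 1) (hm : m < m₀) :
    ¬ HasNAbsorbingFactorization (gapSubalgebra F L d e) m := by
  intro hfac
  have he : 0 < e := hd.trans_le hde
  let x : gapSubalgebra F L d e :=
    ⟨X ^ (e + d - 1), mem_gapSubalgebra_of_X_pow_dvd he (pow_dvd_pow X (by omega))⟩
  have hQle : gapMultiples F L d e (X ^ (2 * e + d - 1)) ≤ Ideal.span {x} := fun f hf => by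
    obtain ⟨q, hq⟩ := mem_gapMultiples.1 hf
    refine Ideal.mem_span_singleton.2
      ⟨⟨X ^ e * q, mem_gapSubalgebra_of_X_pow_dvd he (dvd_mul_right _ _)⟩, Subtype.ext ?_⟩
    change (f : L[X]) = X ^ (e + d - 1) * (X ^ e * q)
    rw [hq, ← mul_assoc, ← pow_add]
    congr 2
    omega
  have hQM : Ideal.span {x} ≤ gapMultiples F L d e X := by
    rw [Ideal.span_singleton_le_iff_mem, mem_gapMultiples]
    exact dvd_pow_self X (by omega)
  have hQtop : Ideal.span {x} ≠ ⊤ := fun h =>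
    gapMultiples_X_ne_top (top_unique (h ▸ hQM))
  have hle : ∀ J : Ideal (gapSubalgebra F L d e), Ideal.span {x} ≤ J → J ≠ ⊤ →
      J ≤ gapMultiples F L d e X := fun J hJ hJ1 => by
    by_contra h
    exact hJ1 (eq_top_of_gapMultiples_X_pow_le (hQle.trans hJ) h)
  have hQm : IsNAbsorbing m (Ideal.span {x}) := by
    obtain ⟨s, hs, hsQ⟩ := hfac _ hQtop
    induction s using Multiset.induction_on with
    | empty => exact absurd (by rw [← hsQ, Multiset.prod_zero, Ideal.one_eq_top]) hQtop
    | cons J t _ =>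
      rw [Multiset.prod_cons] at hsQ
      -- Either `J` is the whole product, or both factors lie in `M`, which would put `X^(e+d-1)` in
      -- `M^2`.
      by_cases ht : t.prod = ⊤
      · rw [ht, Ideal.mul_top] at hsQ
        rw [← hsQ]
        exact hs J (Multiset.mem_cons_self J t)
      · have h1 : x ∈ J * t.prod := hsQ ▸ Ideal.mem_span_singleton_self x
        have h2 := coeff_eq_zero_of_mem_mul hd hde hdk (Ideal.mul_mono
          (hle J (hsQ.symm.le.trans Ideal.mul_le_left) (hs J (Multiset.mem_cons_self J t)).1)
          (hle t.prod (hsQ.symm.le.trans Ideal.mul_le_right) ht) h1)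
        exact absurd ((coeff_X_pow_self _).symm.trans h2) one_ne_zero
  -- These `m + 1` positive exponents sum to `m₀`: the full product reaches degree `d m₀ ≥ 2e + d -
  -- 1`, while dropping any factor leaves at most `d (m₀ - 1)`.
  let t : Fin (m + 1) → ℕ := Fin.cons (m₀ - m) fun _ => 1
  have ht : ∀ i, 1 ≤ t i := fun i => by
    refine Fin.cases ?_ (fun j => ?_) i
    · change 1 ≤ m₀ - m
      omega
    · exact le_rfl
  have htsum : ∑ i, t i = m₀ := by
    rw [Fin.sum_univ_succ]
    simp only [t, Fin.cons_zero, Fin.cons_succ, Finset.sum_const, Finset.card_univ,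
      Fintype.card_fin, smul_eq_mul]
    omega
  let y : Fin (m + 1) → gapSubalgebra F L d e := fun i =>
    ⟨X ^ (d * t i), X_pow_mul_mem_gapSubalgebra hd (t i)⟩
  have hy : ∀ S : Finset (Fin (m + 1)),
      ((∏ i ∈ S, y i : gapSubalgebra F L d e) : L[X]) = X ^ (d * ∑ i ∈ S, t i) := fun S => by
    rw [Finset.mul_sum, ← Finset.prod_pow_eq_pow_sum]
    simp [y]
  obtain ⟨i, hi⟩ := hQm.2 y (hQle (mem_gapMultiples.2 (by
    rw [hy, htsum]
    exact pow_dvd_pow X hm₀)))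
  refine X_pow_mul_notMem_span hdk rfl ?_ (hy _) hi
  refine lt_of_le_of_lt (Nat.mul_le_mul_left d ?_) hm₀'
  have h1 := Finset.add_sum_erase Finset.univ t (Finset.mem_univ i)
  have h2 := ht i
  omega

theorem AFdim_gapSubalgebra (hd : 0 < d) (hde : d ≤ e) (hdk : ¬ d ∣ e + d - 1) {m₀ : ℕ}
    (hm₀ : 2 * e + d - 1 ≤ d * m₀) (hm₀' : d * (m₀ - 1) < 2 * e + d - 1) :
    AFdim (gapSubalgebra F L d e) = m₀ := by
  have h1 : 1 ≤ m₀ := by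
    rcases Nat.eq_zero_or_pos m₀ with rfl | h
    · omega
    · exact h
  refine le_antisymm
    (iInf₂_le m₀ ⟨h1, hasNAbsorbingFactorization_gapSubalgebra hd hde hm₀⟩)
    (le_iInf₂ fun m hm => ?_)
  · by_contra h
    exact not_hasNAbsorbingFactorization_gapSubalgebra hd hde hdk hm₀ hm₀'
      (by exact_mod_cast not_le.1 h) hm.2

theorem isFAFDomain_gapSubalgebra (hd : 0 < d) (hde : d ≤ e) (hdk : ¬ d ∣ e + d - 1) {m₀ : ℕ}
    (hm₀ : 2 * e + d - 1 ≤ d * m₀) (hm₀' : d * (m₀ - 1) < 2 * e + d - 1) :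
    IsFAFDomain (gapSubalgebra F L d e) :=
  ⟨inferInstance, by
    rw [AFdim_gapSubalgebra hd hde hdk hm₀ hm₀']
    exact ENat.natCast_ne_top m₀⟩

end AFdim

/-! ### Noetherianity -/

section Noetherian

variable {F L : Type*} [Field F] [Field L] [Algebra F L] {d e : ℕ}

/-- `L[X]` is of finite type over `F` and integral, hence finite, over the gap ring; Artin–Tate
makes the gap ring of finite type over `F`. -/
theorem isNoetherianRing_gapSubalgebra (he : 0 < e) [FiniteDimensional F L] :
    IsNoetherianRing (gapSubalgebra F L d e) := by
  have hft : Algebra.FiniteType F L[X] := Algebra.FiniteType.trans (S := L) inferInstance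
    inferInstance
  have hft' : Algebra.FiniteType (gapSubalgebra F L d e) L[X] :=
    Algebra.FiniteType.of_restrictScalars_finiteType F _ _
  have hX : IsIntegral (gapSubalgebra F L d e) (X : L[X]) := by
    refine IsIntegral.of_pow he ?_
    exact isIntegral_algebraMap (R := gapSubalgebra F L d e)
      (x := ⟨X ^ e, mem_gapSubalgebra_of_X_pow_dvd he dvd_rfl⟩)
  have hC : ∀ a : L, IsIntegral (gapSubalgebra F L d e) (C a : L[X]) := fun a => by
    have h1 : IsIntegral F (C a : L[X]) :=
      (Algebra.IsIntegral.isIntegral (R := F) a).map (IsScalarTower.toAlgHom F L L[X])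
    exact h1.tower_top
  have hint : Algebra.IsIntegral (gapSubalgebra F L d e) L[X] := ⟨fun p => by
    induction p using Polynomial.induction_on' with
    | add p q hp hq => exact hp.add hq
    | monomial i a =>
      rw [← C_mul_X_pow_eq_monomial]
      exact (hC a).mul (hX.pow i)⟩
  have hfin : Module.Finite (gapSubalgebra F L d e) L[X] := Algebra.IsIntegral.finite
  have hfg : Algebra.FiniteType F (gapSubalgebra F L d e) :=
    ⟨fg_of_fg_of_fg F (gapSubalgebra F L d e) L[X] hft.out hfin.fg_top Subtype.val_injective⟩
  exact Algebra.FiniteType.isNoetherianRing F _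

/-- On `X^e L[X]` the ring acts on the coefficient of `X^e` through its constant terms, which lie in
`F`. Ideal generators thus yield a finite spanning set of `L` over `F`. -/
theorem finiteDimensional_of_isNoetherianRing_gapSubalgebra (he : 0 < e)
    [IsNoetherianRing (gapSubalgebra F L d e)] : FiniteDimensional F L := by
  obtain ⟨s, hs⟩ := IsNoetherian.noetherian (gapMultiples F L d e (X ^ e))
  classical
  let c : gapSubalgebra F L d e → L := fun f => (f : L[X]).coeff e
  refine ⟨⟨s.image c, top_unique fun l _ => ?_⟩⟩
  have key : ∀ f ∈ gapMultiples F L d e (X ^ e), (f : L[X]).coeff e ∈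
      Submodule.span F ((s.image c : Finset L) : Set L) := by
    intro f hf
    rw [← hs] at hf
    refine Submodule.span_induction (fun f hf => ?_) ?_ (fun f g _ _ hf hg => ?_)
      (fun a f hfs hf => ?_) hf
    · exact Submodule.subset_span (Finset.mem_coe.2 (Finset.mem_image_of_mem c hf))
    · exact zero_mem _
    · exact add_mem hf hg
    · rw [hs] at hfs
      obtain ⟨q, hq⟩ := mem_gapMultiples.1 hfs
      obtain ⟨b, hb⟩ := a.2.1
      have : ((a • f : gapSubalgebra F L d e) : L[X]).coeff e = b • (f : L[X]).coeff e := by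
        change ((a : L[X]) * (f : L[X])).coeff e = _
        rw [hq, mul_left_comm, coeff_X_pow_mul', coeff_X_pow_mul', if_pos le_rfl, if_pos le_rfl,
          Nat.sub_self, mul_coeff_zero, ← hb, Algebra.smul_def]
      rw [this]
      exact Submodule.smul_mem _ b hf
  have h1 := key ⟨X ^ e * C l, mem_gapSubalgebra_of_X_pow_dvd he (dvd_mul_right _ _)⟩
    (mem_gapMultiples.2 (dvd_mul_right _ _))
  simpa using h1

theorem isNoetherianRing_gapSubalgebra_iff (he : 0 < e) :
    IsNoetherianRing (gapSubalgebra F L d e) ↔ FiniteDimensional F L :=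
  ⟨fun _ => finiteDimensional_of_isNoetherianRing_gapSubalgebra (d := d) he,
    fun _ => isNoetherianRing_gapSubalgebra he⟩

end Noetherian

/-! ### The Mori property -/

section Mori

variable {F L : Type*} [Field F] [Field L] [Algebra F L] {d e : ℕ}

theorem gapSubalgebra_subset_self {p : L[X]} (hp : p ∈ gapSubalgebra F L d e) :
    p ∈ gapSubalgebra L L d e :=
  ⟨⟨_, rfl⟩, hp.2⟩

variable (F L d e) in
/-- The inclusion of the gap ring into the one with arbitrary constant terms. -/
noncomputable def gapInclusion : gapSubalgebra F L d e →+* gapSubalgebra L L d e where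
  toFun f := ⟨f, gapSubalgebra_subset_self f.2⟩
  map_one' := rfl
  map_mul' _ _ := rfl
  map_zero' := rfl
  map_add' _ _ := rfl

theorem exists_finset_map_eq_span {A B : Type*} [CommRing A] [CommRing B] [IsNoetherianRing B]
    (ι : A →+* B) (I : Ideal A) :
    ∃ s : Finset A, (∀ f ∈ s, f ∈ I) ∧ I.map ι = Ideal.span (ι '' (s : Set A)) := by
  classical
  obtain ⟨t, htI, ht⟩ := (Submodule.fg_span_iff_fg_span_finset_subset (ι '' (I : Set A))).1
    (IsNoetherian.noetherian (Ideal.span (ι '' (I : Set A))))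
  obtain ⟨s, hsI, rfl⟩ := Finset.subset_set_image_iff.1 htI
  refine ⟨s, fun f hf => hsI hf, ?_⟩
  rw [Finset.coe_image] at ht
  exact ht

/-- In an ascending chain of ideals, finitely many elements of one member already control which
fractions `p / q` send all later members into the ideal of elements without constant term. -/
theorem exists_finset_mul_mem_gapMultiples_X (he : 0 < e)
    (I : ℕ → Ideal (gapSubalgebra F L d e)) (hI : Monotone I) :
    ∃ (m : ℕ) (s : Finset (gapSubalgebra F L d e)), (∀ f ∈ s, f ∈ I m) ∧
      ∀ k, m ≤ k → ∀ p q : gapSubalgebra F L d e,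
        (∀ f ∈ s, ∃ a ∈ gapMultiples F L d e X, p * f = q * a) →
        ∀ f ∈ I k, ∃ a ∈ gapMultiples F L d e X, p * f = q * a := by
  have hB : IsNoetherianRing (gapSubalgebra L L d e) := isNoetherianRing_gapSubalgebra he
  -- The chain extended to the ring with constants in `L` stabilizes, since that ring is Noetherian.
  let ι := gapInclusion F L d e
  obtain ⟨m, hm⟩ := monotone_stabilizes_iff_noetherian.2 hB
    ⟨fun k => (I k).map ι, fun i j hij => Ideal.map_mono (hI hij)⟩
  obtain ⟨s, hsI, ht⟩ := exists_finset_map_eq_span ι (I m)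
  refine ⟨m, s, hsI, fun k hk p q hx f hf => ?_⟩
  have hfk : ι f ∈ Ideal.span (ι '' (s : Set (gapSubalgebra F L d e))) := by
    rw [← ht]
    have h1 : ι f ∈ (I k).map ι := Ideal.mem_map_of_mem ι hf
    have h2 : (I m).map ι = (I k).map ι := hm k hk
    rwa [← h2] at h1
  have key : ∃ a ∈ gapMultiples F L d e X,
      (p : L[X]) * ((ι f : gapSubalgebra L L d e) : L[X]) = q * a := by
    refine Submodule.span_induction (p := fun (b : gapSubalgebra L L d e) _ => ∃ a ∈ gapMultiples F L d e X,
      (p : L[X]) * (b : L[X]) = q * a) (fun b hb => ?_) ?_ ?_ ?_ hfk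
    · obtain ⟨f, hf, rfl⟩ := hb
      obtain ⟨a, ha, hfa⟩ := hx f hf
      exact ⟨a, ha, congrArg Subtype.val hfa⟩
    · exact ⟨0, zero_mem _, by simp⟩
    · rintro b c _ _ ⟨a, ha, hab⟩ ⟨a', ha', hac⟩
      refine ⟨a + a', add_mem ha ha', ?_⟩
      change (p : L[X]) * ((b : L[X]) + (c : L[X])) = q * ((a : L[X]) + (a' : L[X]))
      rw [mul_add, hab, hac, mul_add]
    -- Here `M` must be stable under the larger ring: `c a` has constant term `0`, so it is back in
    -- the gap ring.
    · rintro c b _ ⟨a, ha, hab⟩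
      have hX : X ∣ (c : L[X]) * (a : L[X]) := (mem_gapMultiples.1 ha).mul_left _
      refine ⟨⟨(c : L[X]) * a, ⟨0, ?_⟩, ?_⟩, mem_gapMultiples.2 hX, ?_⟩
      · rw [X_dvd_iff.1 hX, map_zero]
      · exact (mul_mem c.2 (gapSubalgebra_subset_self a.2)).2
      · change (p : L[X]) * ((c : L[X]) * (b : L[X])) = q * ((c : L[X]) * (a : L[X]))
        rw [mul_left_comm, hab, mul_left_comm]
  obtain ⟨a, ha, hfa⟩ := key
  exact ⟨a, ha, Subtype.ext hfa⟩

theorem mem_one_div_idealInFractionRing {A : Type*} [CommRing A] {I : Ideal A}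
    {x : FractionRing A} : x ∈ 1 / idealInFractionRing I ↔
      ∀ f ∈ I, ∃ a : A, x * algebraMap A (FractionRing A) f = algebraMap A (FractionRing A) a := by
  rw [Submodule.mem_div_iff_forall_mul_mem]
  constructor
  · intro h f hf
    obtain ⟨a, ha⟩ := Submodule.mem_one.1 (h _ (Submodule.mem_map_of_mem hf))
    exact ⟨a, ha.symm⟩
  · rintro h _ ⟨f, hf, rfl⟩
    obtain ⟨a, ha⟩ := h f hf
    exact Submodule.mem_one.2 ⟨a, ha.symm⟩

/-- A domain is Mori if, with respect to some maximal ideal `M`, in every ascending chain of ideals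
finitely many elements of one member control which fractions send all later members into `M`. -/
theorem isMoriDomain_of_exists_finset {A : Type*} [CommRing A] [IsDomain A] (M : Ideal A)
    [hMax : M.IsMaximal]
    (h : ∀ I : ℕ → Ideal A, Monotone I → ∃ (m : ℕ) (s : Finset A), (∀ f ∈ s, f ∈ I m) ∧
      ∀ k, m ≤ k → ∀ p q : A, (∀ f ∈ s, ∃ a ∈ M, p * f = q * a) →
        ∀ f ∈ I k, ∃ a ∈ M, p * f = q * a) : IsMoriDomain A := by
  refine ⟨inferInstance, fun I hdiv hI => ?_⟩
  let K := FractionRing A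
  obtain ⟨m₀, s, hs, hsI⟩ := h I hI
  replace hsI : ∀ k, m₀ ≤ k → ∀ x : K,
      (∀ f ∈ s, ∃ a ∈ M, x * algebraMap A K f = algebraMap A K a) →
      ∀ f ∈ I k, ∃ a ∈ M, x * algebraMap A K f = algebraMap A K a := fun k hk x => by
    obtain ⟨p, q, hq0, rfl⟩ := IsFractionRing.div_surjective (A := A) x
    have hq : algebraMap A K q ≠ 0 := IsFractionRing.to_map_ne_zero_of_mem_nonZeroDivisors hq0
    have hiff : ∀ f a : A, algebraMap A K p / algebraMap A K q * algebraMap A K f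
        = algebraMap A K a ↔ p * f = q * a := fun f a => by
      rw [div_mul_eq_mul_div, div_eq_iff hq, ← map_mul, ← map_mul, mul_comm a q]
      exact (IsFractionRing.injective A K).eq_iff
    simp only [hiff]
    exact hsI k hk p q
  let J : ℕ → Submodule A K := fun k => 1 / idealInFractionRing (I k)
  have hJ : ∀ i j, i ≤ j → J j ≤ J i := fun i j hij x hx =>
    mem_one_div_idealInFractionRing.2 fun f hf => mem_one_div_idealInFractionRing.1 hx f (hI hij hf)
  have hinj : Function.Injective (Algebra.linearMap A K) := IsFractionRing.injective A K
  let toA : (Algebra.linearMap A K).range →ₗ[A] A :=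
    (LinearEquiv.ofInjective (Algebra.linearMap A K) hinj).symm.toLinearMap
  have htoA : ∀ (y : (Algebra.linearMap A K).range) (a : A), (y : K) = algebraMap A K a →
      toA y = a := fun y a hya => by
    have : y = LinearEquiv.ofInjective (Algebra.linearMap A K) hinj a := Subtype.ext hya
    rw [this]
    exact LinearEquiv.symm_apply_apply _ _
  -- `θ` sends `x` to the classes of `x f` modulo `M`. Its kernel lies in every later `J k`, so each
  -- such `J k` is determined by its image in a module of finite length, and the descending chain
  -- `J` stabilizes.
  let θ : J m₀ →ₗ[A] (s → A ⧸ M) := LinearMap.pi fun f =>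
    M.mkQ ∘ₗ toA ∘ₗ LinearMap.codRestrict _
      ((LinearMap.mulRight A (algebraMap A K f)) ∘ₗ (J m₀).subtype) fun x => by
        obtain ⟨a, ha⟩ := mem_one_div_idealInFractionRing.1 x.2 f (hs f f.2)
        exact ⟨a, ha.symm⟩
  have hθ : ∀ (x : J m₀) (f : s) (a : A), (x : K) * algebraMap A K f = algebraMap A K a →
      θ x f = Ideal.Quotient.mk M a := fun x f a hxa => by
    change M.mkQ (toA _) = M.mkQ a
    congr 1
    exact htoA _ _ hxa
  have hker : ∀ x : J m₀, θ x = 0 → ∀ k, m₀ ≤ k → (x : K) ∈ J k := fun x hx k hk => by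
    refine mem_one_div_idealInFractionRing.2 fun f hf => ?_
    have hxM : ∀ f ∈ s, ∃ a ∈ M, (x : K) * algebraMap A K f = algebraMap A K a := fun f hf => by
      obtain ⟨a, ha⟩ := mem_one_div_idealInFractionRing.1 x.2 f (hs f hf)
      refine ⟨a, Ideal.Quotient.eq_zero_iff_mem.1 ?_, ha⟩
      rw [← hθ x ⟨f, hf⟩ a ha, hx]
      rfl
    obtain ⟨a, -, ha⟩ := hsI k hk x hxM f hf
    exact ⟨a, ha⟩
  have hM : IsSimpleModule A (A ⧸ M) :=
    isSimpleModule_iff_isCoatom.2 hMax.out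
  obtain ⟨m₁, hm₁⟩ := IsArtinian.monotone_stabilizes
    (⟨fun k => OrderDual.toDual (((J k).comap (J m₀).subtype).map θ), fun i j hij =>
      OrderDual.toDual_le_toDual.2 (Submodule.map_mono (Submodule.comap_mono (hJ i j hij)))⟩ :
      ℕ →o (Submodule A (s → A ⧸ M))ᵒᵈ)
  have hstab : ∀ i j, m₀ ≤ i → m₁ ≤ i → i ≤ j → J i = J j := fun i j h0 h1 hij => by
    refine le_antisymm (fun x hx => ?_) (hJ i j hij)
    have h2 : ((J i).comap (J m₀).subtype).map θ = ((J j).comap (J m₀).subtype).map θ :=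
      (hm₁ i h1).symm.trans (hm₁ j (h1.trans hij))
    have h3 : θ ⟨x, hJ m₀ i h0 hx⟩ ∈ ((J i).comap (J m₀).subtype).map θ :=
      Submodule.mem_map_of_mem hx
    rw [h2] at h3
    obtain ⟨y, hy, hyx⟩ := h3
    have h4 := hker (⟨x, hJ m₀ i h0 hx⟩ - y) (by rw [map_sub, hyx, sub_self]) j (h0.trans hij)
    have h5 := add_mem h4 hy
    simpa using h5
  refine ⟨max m₀ m₁, fun k hk => ?_⟩
  -- A divisorial ideal is recovered from its inverse `J k`.
  have h1 : idealInFractionRing (I k) = idealInFractionRing (I (max m₀ m₁)) := by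
    rw [← (hdiv k).2, ← (hdiv (max m₀ m₁)).2]
    exact congrArg (1 / ·) (hstab _ k (le_max_left _ _) (le_max_right _ _) hk).symm
  exact Submodule.map_injective_of_injective hinj h1

theorem isMoriDomain_gapSubalgebra (he : 0 < e) : IsMoriDomain (gapSubalgebra F L d e) := by
  have := isMaximal_gapMultiples_X (F := F) (L := L) (d := d) (e := e)
  exact isMoriDomain_of_exists_finset (gapMultiples F L d e X)
    (exists_finset_mul_mem_gapMultiples_X he)

end Mori

/-! ### The two rings of the theorem -/

theorem evenGapRing_eq_gapSubalgebra (F L : Type*) [Field F] [Field L] [Algebra F L] (n : ℕ) :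
    evenGapRing F L n = gapSubalgebra F L 2 (2 * n + 2) :=
  Subalgebra.copy_eq _ _ _

theorem tripleGapRing_eq_gapSubalgebra (F L : Type*) [Field F] [Field L] [Algebra F L] (n : ℕ) :
    tripleGapRing F L n = gapSubalgebra F L 3 (3 * n + 2) :=
  Subalgebra.copy_eq _ _ _

theorem corollary4p8 (F L : Type*) [Field F] [Field L] [Algebra F L] (n : ℕ) (hn : 1 ≤ n) :
    (IsMoriDomain (evenGapRing F L n) ∧ IsFAFDomain (evenGapRing F L n)) ∧
    (IsMoriDomain (tripleGapRing F L n) ∧ IsFAFDomain (tripleGapRing F L n)) ∧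
    (IsNoetherianRing (evenGapRing F L n) ↔ FiniteDimensional F L) ∧
    (IsNoetherianRing (tripleGapRing F L n) ↔ FiniteDimensional F L) ∧
    AFdim (evenGapRing F L n) = ((2 * n + 3 : ℕ) : ℕ∞) ∧
    AFdim (tripleGapRing F L n) = ((2 * n + 2 : ℕ) : ℕ∞) := by
  rw [evenGapRing_eq_gapSubalgebra, tripleGapRing_eq_gapSubalgebra]
  -- The bound `2e + d - 1` is `4n + 5` for `d = 2` and `6n + 6` for `d = 3`; dividing by `d` and
  -- rounding up gives `2n + 3` and `2n + 2`.
  refine ⟨⟨isMoriDomain_gapSubalgebra (by omega), isFAFDomain_gapSubalgebra (m₀ := 2 * n + 3)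
      ?_ ?_ ?_ ?_ ?_⟩,
    ⟨isMoriDomain_gapSubalgebra (by omega), isFAFDomain_gapSubalgebra (m₀ := 2 * n + 2)
      ?_ ?_ ?_ ?_ ?_⟩,
    isNoetherianRing_gapSubalgebra_iff (by omega), isNoetherianRing_gapSubalgebra_iff (by omega),
    AFdim_gapSubalgebra ?_ ?_ ?_ ?_ ?_, AFdim_gapSubalgebra ?_ ?_ ?_ ?_ ?_⟩ <;> omega
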